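/- **Notation.** For $a>0$ let $G_a$ denote a gamma$(a,1)$ random variable, and for $a,b>0$ let $\beta_{a,b}$ denote a beta$(a,b)$ random variable; put $G_0:=0$ and $\beta_{a,0}:=1$. For $a_1,\dots,a_k\ge 0$, not all zero, the Dirichlet distribution with parameters $(a_1,\dots,a_k)$ is the law of $(G_{a_1},\dots,G_{a_k})/(G_{a_1}+\cdots+G_{a_k})$ with $G_{a_1},\dots,G_{a_k}$ independent. For $\theta>0$ and a probability law $F$ on $[0,\infty)$, a Dirichlet process with parameters $(\theta,F)$ is a random probability measure $P$ on $[0,\infty)$ such that for every finite measurable partition $(C_1,\dots,C_k)$ of $[0,\infty)$ the vector $(P(C_1),\dots,P(C_k))$ has the Dirichlet distribution with parameters $(\theta F(C_1),\dots,\theta F(C_k))$. The Dirichlet mean $M_\theta(F)$ is any random variable with the law of $\int_0^\infty x\,P(\mathrm dx)\in[0,\infty]$ for such a $P$ (values in $[0,\infty]$ are allowed, so no moment condition is imposed). $\mathrm{GGC}(\theta,F)$ denotes the law of $G_\theta M_\theta(F)$ with $G_\theta$ and $M_\theta(F)$ independent. $F_Z$ denotes the law of $Z$, and $\stackrel{d}{=}$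 equality in law. **Theorem 2.1.** Let $\theta>0$ and $0<\sigma\le 1$. Let $X$ be a random variable with values in $[0,\infty)$ and let $Y_\sigma$ be a Bernoulli random variable with success probability $\sigma$, independent of $X$. In each product below the two factors are independent. Then: 1. $\beta_{\theta\sigma,\theta(1-\sigma)}\,M_{\theta\sigma}(F_X)\stackrel{d}{=}M_\theta(F_{XY_\sigma})$; 2. $M_\theta(F_{Y_\sigma})\,M_{\theta\sigma}(F_X)\stackrel{d}{=}M_\theta(F_{XY_\sigma})$; 3. $G_{\theta\sigma}\,M_{\theta\sigma}(F_X)\stackrel{d}{=}G_\theta\,M_\theta(F_{XY_\sigma})$; 4. $\mathrm{GGC}(\theta\sigma,F_X)=\mathrm{GGC}(\theta,F_{XY_\sigma})$. -/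

import Mathlib

open MeasureTheory ProbabilityTheory
open scoped NNReal ENNReal

/-- The gamma distribution on `ℝ` with shape `a ≥ 0` and rate `1`; shape `0` gives the point mass
at `0`. -/
noncomputable def gammaLaw (a : ℝ) : Measure ℝ :=
  if a = 0 then Measure.dirac 0 else gammaMeasure a 1

/-- The beta distribution with parameters `a > 0` and `b ≥ 0`, with the convention that the
beta variable with parameters `(a, 0)` is the constant `1`. -/
noncomputable def betaLaw (a b : ℝ) : Measure ℝ :=
  if b = 0 then Measure.dirac 1 else betaMeasure a b

/-- The `k`-variate Dirichlet distribution with parameters `a 0, …, a (k - 1) ≥ 0` (not all zero):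
the law of the vector `(G i / ∑ j, G j)` where the `G i` are independent with gamma laws of
shapes `a i`. -/
noncomputable def dirichletLaw {k : ℕ} (a : Fin k → ℝ) : Measure (Fin k → ℝ) :=
  (Measure.pi fun i => gammaLaw (a i)).map fun g i => g i / ∑ j, g j

/-- `P` is, under the probability `μ`, a Dirichlet process on `[0, ∞)` with total mass `θ` and
prior (base) probability law `F`: a random probability measure whose values on every finite
measurable partition `C` of `[0, ∞)` are jointly Dirichlet with parameters `θ * F (C i)`. -/
structure IsDirichletProcess {Ω : Type*} [MeasurableSpace Ω] (θ : ℝ) (F : Measure ℝ≥0)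
    (P : Ω → Measure ℝ≥0) (μ : Measure Ω) : Prop where
  measurable : Measurable P
  isProbabilityMeasure : ∀ᵐ ω ∂μ, IsProbabilityMeasure (P ω)
  map_partition : ∀ (k : ℕ) (C : Fin k → Set ℝ≥0), (∀ i, MeasurableSet (C i)) →
    Pairwise (fun i j => Disjoint (C i) (C j)) → ⋃ i, C i = Set.univ →
    μ.map (fun ω i => (P ω).real (C i)) = dirichletLaw fun i => θ * F.real (C i)

/-- `M` is, under `μ`, a Dirichlet mean of order `θ` with base law `F`: it has the law of
`∫ x P(dx)` for a Dirichlet process `P` with parameters `(θ, F)`. The integral of the nonnegative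
function `x` is taken in `[0, ∞]`, so it always makes sense. -/
def IsDirichletMean {Ω : Type*} [MeasurableSpace Ω] (θ : ℝ) (F : Measure ℝ≥0)
    (M : Ω → ℝ≥0∞) (μ : Measure Ω) : Prop :=
  ∃ (Ω' : Type) (_ : MeasurableSpace Ω') (μ' : Measure Ω') (P : Ω' → Measure ℝ≥0),
    IsProbabilityMeasure μ' ∧ IsDirichletProcess θ F P μ' ∧
      IdentDistrib M (fun ω => ∫⁻ x, (x : ℝ≥0∞) ∂(P ω)) μ μ'

/-- `ν` is a law of the class `GGC(θ, F)`: the law of a product `G * M` of independent variables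
where `G` is gamma distributed with shape `θ` and rate `1`, and `M` is a Dirichlet mean of order
`θ` with base law `F`. -/
def IsGGC (θ : ℝ) (F : Measure ℝ≥0) (ν : Measure ℝ≥0∞) : Prop :=
  ∃ (Ω : Type) (_ : MeasurableSpace Ω) (μ : Measure Ω) (G : Ω → ℝ) (M : Ω → ℝ≥0∞),
    IsProbabilityMeasure μ ∧ HasLaw G (gammaLaw θ) μ ∧ IsDirichletMean θ F M μ ∧
      IndepFun G M μ ∧ HasLaw (fun ω => ENNReal.ofReal (G ω) * M ω) ν μ

/-!
The product `G * β` of independent variables with gamma `(a + b)` and beta `(a, b)` laws is again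
gamma distributed, with shape `a`, and it is independent of `G * (1 - β)`, which has shape `b`
(`lintegral_gammaLaw_betaLaw`). By induction on the number of coordinates, a vector of independent
gamma variables with total shape `A` is the product of a gamma `(A)` variable and an independent
Dirichlet vector (`dirichletLaw_spec`). Together these give the mixture rule for Dirichlet vectors:
if `D` is Dirichlet with parameters `a` of sum `A` and `B` is an independent beta `(A, b)` variable,
then `B • D + (1 - B) • e j` is Dirichlet with parameters `a + b • e j`
(`dirichletLaw_add_single`).

Applied to the finite-dimensional laws, the mixture rule says that if `P` is a Dirichlet process with
parameters `(a, F)`, then `B • P + (1 - B) • δ₀` is a Dirichlet process whose parameter measure is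
`a • F + b • δ₀` (`IsDirichletProcess.smul_add_dirac`). With `a = θσ` and `b = θ(1 - σ)` this
parameter measure is `θ • F_{XY}`, because `F_{XY} = σ • F_X + (1 - σ) • δ₀`
(`map_mul_bernoulli_real`). The atom at `0` does not contribute to `∫ x P(dx)`, so the mean of the
new process is `B` times the mean of `P`. Since the law of a Dirichlet mean depends only on its
parameters (`IsDirichletProcess.map_lintegral_eq`), this is (i). In the special case `X = 1` the mean
of `P` is `1`, so the Dirichlet mean of `F_Y` is the beta variable itself, which gives (ii).
Multiplying by an independent gamma `(θ)` variable gives (iii) by the beta-gamma algebra.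

Statement (iv) is (iii) together with the fact that one of the two Dirichlet means exists as soon as
the other does. One direction is the mixture above. For the other, a Dirichlet process for `F_{XY}`
conditioned on `(0, ∞)` is a Dirichlet process for `F_X` conditioned on `(0, ∞)`
(`IsDirichletProcess.cond`), and a second mixture puts the atom of `F_X` at `0` back
(`IsDirichletMean.exists_of_mixture`).
-/

/-! ### The beta-gamma algebra -/

theorem lintegral_comp_mul_left_real {g : ℝ} (hg : g ≠ 0) {h : ℝ → ℝ≥0∞} (hh : Measurable h) :
    ∫⁻ u, h (g * u) = ENNReal.ofReal |g⁻¹| * ∫⁻ x, h x := by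
  rw [← lintegral_map hh (measurable_const_mul g), Real.map_volume_mul_left hg,
    lintegral_smul_measure, smul_eq_mul]

theorem measurable_gammaPDF (a r : ℝ) : Measurable (gammaPDF a r) :=
  (measurable_gammaPDFReal a r).ennreal_ofReal

theorem measurable_betaPDF (a b : ℝ) : Measurable (betaPDF a b) :=
  (measurable_betaPDFReal a b).ennreal_ofReal

/-- The density form of the beta-gamma algebra: `|g|⁻¹` is the Jacobian of `x = g * u`.
The excluded points `0` and `g` are those where the conventions for the densities differ. -/
theorem gammaPDF_mul_betaPDF_div {a b : ℝ} (ha : 0 < a) (hb : 0 < b) {g x : ℝ} (hg : g ≠ 0)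
    (hx : x ≠ 0) (hxg : x ≠ g) :
    gammaPDF (a + b) 1 g * (ENNReal.ofReal |g⁻¹| * betaPDF a b (x / g))
      = gammaPDF a 1 x * gammaPDF b 1 (g - x) := by
  rcases lt_or_gt_of_ne hg with hg | hg
  · rw [gammaPDF_of_neg hg, zero_mul]
    rcases lt_or_gt_of_ne hx with hx | hx
    · rw [gammaPDF_of_neg hx, zero_mul]
    · rw [gammaPDF_of_neg (by linarith : g - x < 0), mul_zero]
  rcases lt_or_gt_of_ne hx with hx | hx
  · rw [gammaPDF_of_neg hx, zero_mul, betaPDF_eq_zero_of_nonpos (div_neg_of_neg_of_pos hx hg).le]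
    simp
  rcases lt_or_gt_of_ne hxg with hxg | hxg
  swap
  · rw [gammaPDF_of_neg (by linarith : g - x < 0), mul_zero,
      betaPDF_eq_zero_of_one_le ((one_le_div hg).2 hxg.le)]
    simp
  have hd : 0 < g - x := by linarith
  rw [gammaPDF_of_nonneg hg.le, gammaPDF_of_nonneg hx.le, gammaPDF_of_nonneg hd.le,
    betaPDF_of_pos_lt_one (div_pos hx hg) ((div_lt_one hg).2 hxg),
    ← ENNReal.ofReal_mul (abs_nonneg _), ← ENNReal.ofReal_mul (by positivity),
    ← ENNReal.ofReal_mul (by positivity)]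
  congr 1
  have h1 : 1 - x / g = (g - x) / g := by field_simp
  have hG := (Real.Gamma_pos_of_pos ha).ne'
  have hG' := (Real.Gamma_pos_of_pos hb).ne'
  have hG'' := (Real.Gamma_pos_of_pos (add_pos ha hb)).ne'
  have h2 : g ^ (a + b - 1) = g * g ^ (a - 1) * g ^ (b - 1) := by
    rw [show a + b - 1 = 1 + (a - 1) + (b - 1) by ring, Real.rpow_add hg, Real.rpow_add hg,
      Real.rpow_one]
  have h3 : Real.exp (-(1 * g)) = Real.exp (-(1 * x)) * Real.exp (-(1 * (g - x))) := by
    rw [← Real.exp_add]; ring_nf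
  rw [h1, Real.div_rpow hx.le hg.le, Real.div_rpow hd.le hg.le, h2, h3, abs_of_pos (inv_pos.2 hg)]
  have := (Real.rpow_pos_of_pos hg (a - 1)).ne'
  have := (Real.rpow_pos_of_pos hg (b - 1)).ne'
  simp only [Real.one_rpow, beta]
  field_simp

theorem lintegral_gammaLaw {a : ℝ} (ha : 0 < a) {f : ℝ → ℝ≥0∞} (hf : Measurable f) :
    ∫⁻ x, f x ∂gammaLaw a = ∫⁻ x, gammaPDF a 1 x * f x := by
  rw [gammaLaw, if_neg ha.ne', gammaMeasure,
    lintegral_withDensity_eq_lintegral_mul _ (measurable_gammaPDF a 1) hf]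
  rfl

theorem lintegral_betaLaw {a b : ℝ} (hb : 0 < b) {f : ℝ → ℝ≥0∞} (hf : Measurable f) :
    ∫⁻ x, f x ∂betaLaw a b = ∫⁻ x, betaPDF a b x * f x := by
  rw [betaLaw, if_neg hb.ne', betaMeasure,
    lintegral_withDensity_eq_lintegral_mul _ (measurable_betaPDF a b) hf]
  rfl

theorem isProbabilityMeasure_gammaLaw {a : ℝ} (ha : 0 ≤ a) :
    IsProbabilityMeasure (gammaLaw a) := by
  rw [gammaLaw]
  split_ifs with h
  · infer_instance
  · exact isProbabilityMeasure_gammaMeasure (ha.lt_of_ne' h) one_pos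

theorem isProbabilityMeasure_betaLaw {a b : ℝ} (ha : 0 < a) (hb : 0 ≤ b) :
    IsProbabilityMeasure (betaLaw a b) := by
  rw [betaLaw]
  split_ifs with h
  · infer_instance
  · exact isProbabilityMeasureBeta ha (hb.lt_of_ne' h)

theorem ae_gammaLaw_nonneg (a : ℝ) : ∀ᵐ x ∂gammaLaw a, 0 ≤ x := by
  rw [gammaLaw]
  split_ifs with h
  · rw [ae_dirac_iff measurableSet_Ici]
  · rw [gammaMeasure, ae_withDensity_iff (measurable_gammaPDF a 1)]
    filter_upwards with x hx
    by_contra hneg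
    exact hx (gammaPDF_of_neg (not_le.1 hneg))

theorem ae_gammaLaw_pos {a : ℝ} (ha : 0 < a) : ∀ᵐ x ∂gammaLaw a, 0 < x := by
  have h0 : ∀ᵐ x ∂gammaLaw a, x ≠ 0 := by
    rw [gammaLaw, if_neg ha.ne']
    exact (withDensity_absolutelyContinuous _ _).ae_le (Measure.ae_ne volume 0)
  filter_upwards [ae_gammaLaw_nonneg a, h0] with x hx hx0 using lt_of_le_of_ne' hx hx0

theorem ae_betaLaw_mem_Icc (a b : ℝ) : ∀ᵐ x ∂betaLaw a b, x ∈ Set.Icc (0 : ℝ) 1 := by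
  rw [betaLaw]
  split_ifs with h
  · exact (ae_dirac_iff (p := (· ∈ Set.Icc (0 : ℝ) 1)) measurableSet_Icc).2 (by simp)
  · rw [betaMeasure, ae_withDensity_iff (measurable_betaPDF a b)]
    filter_upwards with x hx
    by_contra hneg
    rw [Set.mem_Icc, not_and_or, not_le, not_le] at hneg
    rcases hneg with h | h
    · exact hx (betaPDF_eq_zero_of_nonpos h.le)
    · exact hx (betaPDF_eq_zero_of_one_le h.le)

/-- If `g` and `u` are independent with gamma `(a + b)` and beta `(a, b)` laws, then `g * u` and
`g * (1 - u)` are independent with gamma laws of shapes `a` and `b`. -/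
theorem lintegral_gammaLaw_betaLaw {a b : ℝ} (ha : 0 < a) (hb : 0 ≤ b) {f : ℝ × ℝ → ℝ≥0∞}
    (hf : Measurable f) :
    ∫⁻ g, ∫⁻ u, f (g * u, g * (1 - u)) ∂betaLaw a b ∂gammaLaw (a + b)
      = ∫⁻ x, ∫⁻ y, f (x, y) ∂gammaLaw b ∂gammaLaw a := by
  rcases hb.eq_or_lt with rfl | hb
  · simp only [betaLaw, if_true, gammaLaw, add_zero]
    refine lintegral_congr fun g => ?_
    rw [lintegral_dirac' _ (by fun_prop), lintegral_dirac' _ (by fun_prop)]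
    simp
  have hp := measurable_gammaPDF a 1
  have hq := measurable_gammaPDF b 1
  have hr := measurable_betaPDF a b
  have e1 : ∀ g : ℝ, g ≠ 0 → gammaPDF (a + b) 1 g *
      ∫⁻ u, f (g * u, g * (1 - u)) ∂betaLaw a b
      = ∫⁻ x, gammaPDF a 1 x * gammaPDF b 1 (g - x) * f (x, g - x) := by
    intro g hg
    rw [lintegral_betaLaw hb (by fun_prop)]
    have := lintegral_comp_mul_left_real hg (h := fun x => betaPDF a b (x / g) * f (x, g - x))
      (by fun_prop)
    simp only [mul_div_cancel_left₀ _ hg] at this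
    simp only [mul_sub, mul_one]
    rw [this, ← lintegral_const_mul _ (by fun_prop), ← lintegral_const_mul _ (by fun_prop)]
    refine lintegral_congr_ae ?_
    filter_upwards [Measure.ae_ne volume 0, Measure.ae_ne volume g] with x hx hxg
    rw [← gammaPDF_mul_betaPDF_div ha hb hg hx hxg]
    ring
  have := isProbabilityMeasure_betaLaw ha hb.le
  have := isProbabilityMeasure_gammaLaw hb.le
  rw [lintegral_gammaLaw (add_pos ha hb)
    (Measurable.lintegral_prod_right' (f := fun p : ℝ × ℝ => f (p.1 * p.2, p.1 * (1 - p.2)))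
      (by fun_prop))]
  rw [lintegral_congr_ae (g := fun g => ∫⁻ x, gammaPDF a 1 x * gammaPDF b 1 (g - x) * f (x, g - x))
    (by filter_upwards [Measure.ae_ne volume 0] with g hg using e1 g hg)]
  rw [lintegral_lintegral_swap (by fun_prop),
    lintegral_gammaLaw ha (Measurable.lintegral_prod_right' hf)]
  refine lintegral_congr fun x => ?_
  rw [lintegral_gammaLaw hb (by fun_prop), ← lintegral_const_mul _ (by fun_prop),
    ← lintegral_sub_right_eq_self (fun y => gammaPDF a 1 x * (gammaPDF b 1 y * f (x, y))) x]
  simp only [mul_assoc]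

/-- The beta-gamma algebra with both shapes allowed to vanish; for `a = 0` the splitting variable is
constantly `0`, a case which `betaLaw` does not cover. -/
theorem exists_lintegral_gammaLaw_add {a b : ℝ} (ha : 0 ≤ a) (hb : 0 ≤ b) :
    ∃ ρ : Measure ℝ, IsProbabilityMeasure ρ ∧ ∀ f : ℝ × ℝ → ℝ≥0∞, Measurable f →
      ∫⁻ g, ∫⁻ u, f (g * u, g * (1 - u)) ∂ρ ∂gammaLaw (a + b)
        = ∫⁻ x, ∫⁻ y, f (x, y) ∂gammaLaw b ∂gammaLaw a := by
  rcases ha.eq_or_lt with rfl | ha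
  · refine ⟨Measure.dirac 0, inferInstance, fun f hf => ?_⟩
    have := isProbabilityMeasure_gammaLaw hb
    conv_rhs => rw [gammaLaw, if_pos rfl]
    rw [lintegral_dirac' _ (Measurable.lintegral_prod_right' hf), zero_add]
    refine lintegral_congr fun g => ?_
    rw [lintegral_dirac' _ (by fun_prop)]
    simp
  · exact ⟨_, isProbabilityMeasure_betaLaw ha hb, fun f hf => lintegral_gammaLaw_betaLaw ha hb hf⟩

/-- Independent gamma variables with shapes `a` and `b` add up to one of shape `a + b`. -/
theorem lintegral_gammaLaw_add {a b : ℝ} (ha : 0 ≤ a) (hb : 0 ≤ b) {f : ℝ → ℝ≥0∞}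
    (hf : Measurable f) :
    ∫⁻ x, ∫⁻ y, f (x + y) ∂gammaLaw b ∂gammaLaw a = ∫⁻ g, f g ∂gammaLaw (a + b) := by
  obtain ⟨ρ, hρ, h⟩ := exists_lintegral_gammaLaw_add ha hb
  rw [← h (fun p => f (p.1 + p.2)) (by fun_prop)]
  refine lintegral_congr fun g => ?_
  simp [← mul_add]

/-! ### Gamma vectors and the Dirichlet distribution -/

theorem measurable_pi_single_real {k : ℕ} (j : Fin k) :
    Measurable fun x : ℝ => (Pi.single j x : Fin k → ℝ) :=
  measurable_pi_iff.2 fun i => by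
    by_cases h : i = j
    · subst h; simpa using measurable_id'
    · simp [h]

/-- Tonelli's theorem, separating the coordinate `j` of a finite product. -/
theorem lintegral_pi_insertNth {n : ℕ} (ν : Fin (n + 1) → Measure ℝ)
    [∀ i, IsProbabilityMeasure (ν i)] (j : Fin (n + 1)) {f : (Fin (n + 1) → ℝ) → ℝ≥0∞}
    (hf : Measurable f) :
    ∫⁻ x, f x ∂Measure.pi ν
      = ∫⁻ x, ∫⁻ y, f (j.insertNth x y) ∂(Measure.pi fun i => ν (j.succAbove i)) ∂ν j := by
  have h := (measurePreserving_piFinSuccAbove ν j).symm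
  have hm : AEMeasurable (fun p => f ((MeasurableEquiv.piFinSuccAbove (fun _ => ℝ) j).symm p))
    ((ν j).prod (Measure.pi fun i => ν (j.succAbove i))) := (hf.comp h.measurable).aemeasurable
  rw [← h.lintegral_comp hf, lintegral_prod _ hm]
  rfl

/-- A vector of independent gamma variables is a gamma variable, carrying the total shape, times an
independent random vector on the hyperplane of coordinate sum `1`. The coordinate `0` is split off
by the beta-gamma algebra, and the induction hypothesis splits the others. -/
theorem exists_lintegral_gammaLaw_smul {n : ℕ} (a : Fin (n + 1) → ℝ) (ha : ∀ i, 0 ≤ a i) :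
    ∃ δ : Measure (Fin (n + 1) → ℝ), IsProbabilityMeasure δ ∧ (∀ᵐ D ∂δ, ∑ i, D i = 1) ∧
      ∀ f : (Fin (n + 1) → ℝ) → ℝ≥0∞, Measurable f →
        ∫⁻ g, ∫⁻ D, f (g • D) ∂δ ∂gammaLaw (∑ i, a i)
          = ∫⁻ x, f x ∂Measure.pi fun i => gammaLaw (a i) := by
  induction n with
  | zero =>
    have := fun i => isProbabilityMeasure_gammaLaw (ha i)
    refine ⟨Measure.dirac 1, inferInstance, ?_, fun f hf => ?_⟩
    · exact (ae_dirac_iff (p := fun D : Fin 1 → ℝ => ∑ i, D i = 1)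
        (measurableSet_eq_fun (by fun_prop) (by fun_prop))).2 (by simp)
    · have h := (measurePreserving_funUnique (gammaLaw (a 0)) (Fin 1)).symm
      have e : (Measure.pi fun i => gammaLaw (a i)) = Measure.pi fun _ : Fin 1 => gammaLaw (a 0) := by
        congr 1; ext1 i; rw [show i = 0 from Subsingleton.elim (α := Fin 1) i 0]
      rw [e]
      refine Eq.trans ?_ (h.lintegral_comp hf)
      rw [show ∑ i, a i = a 0 from Fin.sum_univ_one a]
      refine lintegral_congr fun g => ?_
      rw [lintegral_dirac' _ (by fun_prop)]
      congr 1
      ext i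
      simp [MeasurableEquiv.funUnique]
  | succ n ih =>
    have := fun i => isProbabilityMeasure_gammaLaw (ha i)
    obtain ⟨δ, hδ, hsum, hδf⟩ := ih (fun i => a (Fin.succAbove 0 i)) fun i => ha _
    obtain ⟨ρ, hρ, hρf⟩ := exists_lintegral_gammaLaw_add (ha 0)
      (Finset.sum_nonneg fun i (_ : i ∈ Finset.univ) => ha (Fin.succAbove 0 i))
    have hT : Measurable fun p : ℝ × (Fin (n + 1) → ℝ) =>
        (Fin.insertNth 0 p.1 ((1 - p.1) • p.2) : Fin (n + 2) → ℝ) := by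
      refine measurable_pi_iff.2 fun i => ?_
      refine Fin.cases ?_ (fun i => ?_) i <;> simp <;> fun_prop
    have hT' : Measurable fun p : (ℝ × ℝ) × (Fin (n + 1) → ℝ) =>
        (Fin.insertNth 0 p.1.1 (p.1.2 • p.2) : Fin (n + 2) → ℝ) := by
      refine measurable_pi_iff.2 fun i => ?_
      refine Fin.cases ?_ (fun i => ?_) i <;> simp <;> fun_prop
    have hI : Measurable fun p : ℝ × (Fin (n + 1) → ℝ) =>
        (Fin.insertNth 0 p.1 p.2 : Fin (n + 2) → ℝ) := by
      refine measurable_pi_iff.2 fun i => ?_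
      refine Fin.cases ?_ (fun i => ?_) i <;> simp <;> fun_prop
    refine ⟨(ρ.prod δ).map _, Measure.isProbabilityMeasure_map hT.aemeasurable, ?_, fun f hf => ?_⟩
    · rw [ae_map_iff hT.aemeasurable (measurableSet_eq_fun (by fun_prop) (by fun_prop))]
      have := Measure.quasiMeasurePreserving_snd (μ := ρ) (ν := δ) |>.ae hsum
      filter_upwards [this] with p hp
      rw [Fin.sum_univ_succAbove _ 0]
      simp [← Finset.mul_sum, hp]
    · rw [lintegral_pi_insertNth _ 0 hf, Fin.sum_univ_succAbove _ 0]
      have e : ∀ x, ∫⁻ y, f (Fin.insertNth 0 x y)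
          ∂(Measure.pi fun i => gammaLaw (a (Fin.succAbove 0 i)))
          = ∫⁻ s, ∫⁻ D, f (Fin.insertNth 0 x (s • D)) ∂δ
            ∂gammaLaw (∑ i, a (Fin.succAbove 0 i)) := by
        intro x
        rw [hδf (fun y => f (Fin.insertNth 0 x y))
          (hf.comp (hI.comp (f := fun y => (x, y)) (by fun_prop)))]
      simp_rw [e]
      rw [← hρf (fun p => ∫⁻ D, f (Fin.insertNth 0 p.1 (p.2 • D)) ∂δ)
        (Measurable.lintegral_prod_right' (hf.comp hT'))]
      refine lintegral_congr fun g => ?_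
      have hg : Measurable fun D : Fin (n + 2) → ℝ => f (g • D) := by fun_prop
      have hgT : Measurable fun p : ℝ × (Fin (n + 1) → ℝ) =>
          f (g • (Fin.insertNth 0 p.1 ((1 - p.1) • p.2) : Fin (n + 2) → ℝ)) := hg.comp hT
      rw [lintegral_map hg hT, lintegral_prod _ hgT.aemeasurable]
      refine lintegral_congr fun u => lintegral_congr fun D => ?_
      congr 1
      ext i
      refine Fin.cases ?_ (fun i => ?_) i <;> simp [mul_assoc]

theorem measurable_div_sum (k : ℕ) :
    Measurable fun (g : Fin k → ℝ) (i : Fin k) => g i / ∑ j, g j := by fun_prop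

theorem lintegral_dirichletLaw {k : ℕ} (a : Fin k → ℝ) {f : (Fin k → ℝ) → ℝ≥0∞}
    (hf : Measurable f) :
    ∫⁻ D, f D ∂dirichletLaw a
      = ∫⁻ g, f (fun i => g i / ∑ j, g j) ∂Measure.pi fun i => gammaLaw (a i) := by
  rw [dirichletLaw, lintegral_map hf (measurable_div_sum k)]

theorem isProbabilityMeasure_dirichletLaw {k : ℕ} {a : Fin k → ℝ} (ha : ∀ i, 0 ≤ a i) :
    IsProbabilityMeasure (dirichletLaw a) := by
  have := fun i => isProbabilityMeasure_gammaLaw (ha i)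
  exact Measure.isProbabilityMeasure_map (measurable_div_sum k).aemeasurable

/-- A vector of independent gamma variables is the product of its sum and of its normalisation, and
the normalisation is independent of the sum. -/
theorem dirichletLaw_spec {k : ℕ} {a : Fin k → ℝ} (ha : ∀ i, 0 ≤ a i) (hA : 0 < ∑ i, a i) :
    (∀ᵐ D ∂dirichletLaw a, ∑ i, D i = 1) ∧
      ∀ f : (Fin k → ℝ) → ℝ≥0∞, Measurable f →
        ∫⁻ g, ∫⁻ D, f (g • D) ∂dirichletLaw a ∂gammaLaw (∑ i, a i)
          = ∫⁻ x, f x ∂Measure.pi fun i => gammaLaw (a i) := by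
  obtain _ | n := k
  · simp at hA
  obtain ⟨δ, hδ, hsum, hδf⟩ := exists_lintegral_gammaLaw_smul a ha
  have := isProbabilityMeasure_gammaLaw hA.le
  suffices h : dirichletLaw a = δ by rw [h]; exact ⟨hsum, hδf⟩
  refine Measure.ext_of_lintegral _ fun f hf => ?_
  rw [lintegral_dirichletLaw a hf, ← hδf (fun x => f fun i => x i / ∑ j, x j)
    (hf.comp (measurable_div_sum _))]
  rw [lintegral_congr_ae (g := fun _ => ∫⁻ D, f D ∂δ), lintegral_const, measure_univ, mul_one]
  filter_upwards [ae_gammaLaw_pos hA] with g hg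
  refine lintegral_congr_ae ?_
  filter_upwards [hsum] with D hD
  congr 1
  ext i
  simp [← Finset.mul_sum, hD, hg.ne']

/-- Adding an independent gamma `(b)` variable to the coordinate `j` raises its shape by `b`. -/
theorem lintegral_pi_gammaLaw_add_single {k : ℕ} {a : Fin k → ℝ} (ha : ∀ i, 0 ≤ a i) {b : ℝ}
    (hb : 0 ≤ b) (j : Fin k) {f : (Fin k → ℝ) → ℝ≥0∞} (hf : Measurable f) :
    ∫⁻ x, ∫⁻ h, f (x + Pi.single j h) ∂gammaLaw b ∂(Measure.pi fun i => gammaLaw (a i))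
      = ∫⁻ x, f x ∂Measure.pi fun i => gammaLaw ((a + Pi.single j b : Fin k → ℝ) i) := by
  obtain _ | n := k
  · exact j.elim0
  have := fun i => isProbabilityMeasure_gammaLaw (ha i)
  have := isProbabilityMeasure_gammaLaw hb
  have := fun i => isProbabilityMeasure_gammaLaw (a := (a + Pi.single j b : Fin (n + 1) → ℝ) i)
    (add_nonneg (ha i) (by by_cases h : i = j <;> simp [h, hb]))
  have hs : Measurable fun p : (Fin (n + 1) → ℝ) × ℝ =>
      p.1 + (Pi.single j p.2 : Fin (n + 1) → ℝ) :=
    measurable_fst.add ((measurable_pi_single_real j).comp measurable_snd)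
  have hI : Measurable fun p : ℝ × (Fin n → ℝ) => (j.insertNth p.1 p.2 : Fin (n + 1) → ℝ) :=
    measurable_pi_iff.2 fun i => by
      refine j.succAboveCases ?_ (fun i => ?_) i <;> simp <;> fun_prop
  have hI' : Measurable fun p : (ℝ × ℝ) × (Fin n → ℝ) =>
      (j.insertNth (p.1.1 + p.1.2) p.2 : Fin (n + 1) → ℝ) := hI.comp
        (f := fun p : (ℝ × ℝ) × (Fin n → ℝ) => (p.1.1 + p.1.2, p.2)) (by fun_prop)
  have hins : ∀ x y h, (j.insertNth x y : Fin (n + 1) → ℝ) + Pi.single j h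
      = j.insertNth (x + h) y := by
    intro x y h
    ext i
    refine j.succAboveCases ?_ (fun i => ?_) i <;> simp
  rw [lintegral_pi_insertNth _ j
      (Measurable.lintegral_prod_right'
        (ν := gammaLaw b)
        (f := fun p : (Fin (n + 1) → ℝ) × ℝ => f (p.1 + (Pi.single j p.2 : Fin (n + 1) → ℝ))) (hf.comp hs)),
    lintegral_pi_insertNth _ j hf]
  simp only [hins, Pi.add_apply, Pi.single_eq_same, Fin.succAbove_ne, ne_eq, not_false_eq_true,
    Pi.single_eq_of_ne, add_zero]
  rw [← lintegral_gammaLaw_add (ha j) hb (f := fun x => ∫⁻ y, f (j.insertNth x y)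
    ∂(Measure.pi fun i => gammaLaw (a (j.succAbove i))))
    (Measurable.lintegral_prod_right' (f := fun p : ℝ × (Fin n → ℝ) => f (j.insertNth p.1 p.2))
      (hf.comp hI))]
  refine lintegral_congr fun x => ?_
  rw [lintegral_lintegral_swap]
  exact (hf.comp (hI'.comp (f := fun p : (Fin n → ℝ) × ℝ => ((x, p.2), p.1))
    (by fun_prop))).aemeasurable

/-- The mixture rule: moving the mass `1 - B` of a Dirichlet vector to the coordinate `j`, where `B`
is an independent beta `(∑ i, a i, b)` variable, adds `b` to the parameter `j`. Both sides become
the same gamma vector when multiplied by an independent gamma variable. -/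
theorem dirichletLaw_add_single {k : ℕ} {a : Fin k → ℝ} (ha : ∀ i, 0 ≤ a i)
    (hA : 0 < ∑ i, a i) {b : ℝ} (hb : 0 ≤ b) (j : Fin k) :
    ((dirichletLaw a).prod (betaLaw (∑ i, a i) b)).map
        (fun p => p.2 • p.1 + Pi.single j (1 - p.2))
      = dirichletLaw (a + Pi.single j b) := by
  have := isProbabilityMeasure_dirichletLaw ha
  have := isProbabilityMeasure_betaLaw hA hb
  have := isProbabilityMeasure_gammaLaw hb
  have := isProbabilityMeasure_gammaLaw hA.le
  have := isProbabilityMeasure_gammaLaw (add_nonneg hA.le hb)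
  have hsi := measurable_pi_single_real j
  have hT : Measurable fun p : (Fin k → ℝ) × ℝ => p.2 • p.1 + Pi.single j (1 - p.2) :=
    Measurable.add (by fun_prop) (hsi.comp (by fun_prop))
  refine Measure.ext_of_lintegral _ fun f hf => ?_
  rw [lintegral_map hf hT, lintegral_dirichletLaw _ hf]
  set N := fun (g : Fin k → ℝ) (i : Fin k) => g i / ∑ j, g j with hN
  have hNm : Measurable N := measurable_div_sum k
  have hfN : Measurable fun x => f (N x) := hf.comp hNm
  change _ = ∫⁻ g, f (N g) ∂_
  rw [← lintegral_pi_gammaLaw_add_single ha hb j hfN]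
  have hm1 : Measurable fun p : (Fin k → ℝ) × ℝ => f (N (p.1 + Pi.single j p.2)) :=
    hfN.comp (measurable_fst.add (hsi.comp measurable_snd))
  have hm2 : Measurable fun p : (ℝ × ℝ) × (Fin k → ℝ) =>
      f (N (p.1.1 • p.2 + Pi.single j p.1.2)) :=
    hm1.comp (f := fun p : (ℝ × ℝ) × (Fin k → ℝ) => (p.1.1 • p.2, p.1.2)) (by fun_prop)
  rw [← (dirichletLaw_spec ha hA).2 _ (Measurable.lintegral_prod_right' hm1)]
  have e1 : ∀ g : ℝ, ∫⁻ D, ∫⁻ h, f (N (g • D + Pi.single j h)) ∂gammaLaw b ∂dirichletLaw a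
      = ∫⁻ h, ∫⁻ D, f (N (g • D + Pi.single j h)) ∂dirichletLaw a ∂gammaLaw b := by
    intro g
    rw [lintegral_lintegral_swap]
    exact (hm2.comp (f := fun p : (Fin k → ℝ) × ℝ => ((g, p.2), p.1)) (by fun_prop)).aemeasurable
  simp_rw [e1]
  rw [← lintegral_gammaLaw_betaLaw hA hb
    (f := fun p => ∫⁻ D, f (N (p.1 • D + (Pi.single j p.2 : Fin k → ℝ))) ∂dirichletLaw a)
    (Measurable.lintegral_prod_right' hm2)]
  have hfT : Measurable fun p : (Fin k → ℝ) × ℝ =>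
    f (p.2 • p.1 + (Pi.single j (1 - p.2) : Fin k → ℝ)) := hf.comp hT
  rw [lintegral_prod_symm' _ hfT]
  rw [lintegral_congr_ae (μ := gammaLaw (∑ i, a i + b)) (g := fun _ => ∫⁻ u, ∫⁻ D,
    f (u • D + Pi.single j (1 - u)) ∂dirichletLaw a ∂betaLaw (∑ i, a i) b), lintegral_const,
    measure_univ, mul_one]
  filter_upwards [ae_gammaLaw_pos (add_pos_of_pos_of_nonneg hA hb)] with g hg
  refine lintegral_congr fun u => lintegral_congr_ae ?_
  filter_upwards [(dirichletLaw_spec ha hA).1] with D hD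
  congr 1
  ext i
  have : ∑ i, ((g * u) • D + (Pi.single j (g * (1 - u)) : Fin k → ℝ)) i = g := by
    simp [Finset.sum_add_distrib, ← Finset.mul_sum, hD]
    ring
  simp only [hN, this]
  by_cases h : i = j
  · subst h; simp; field_simp
  · simp [h]; field_simp

/-- The coordinates other than `0` of a Dirichlet vector, divided by their sum, form a Dirichlet
vector. -/
theorem dirichletLaw_map_succ_div_sum {n : ℕ} {a : Fin (n + 1) → ℝ} (ha : ∀ i, 0 ≤ a i) :
    (dirichletLaw a).map (fun D i => D (Fin.succ i) / ∑ j : Fin n, D (Fin.succ j))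
      = dirichletLaw fun i : Fin n => a i.succ := by
  have := fun i => isProbabilityMeasure_gammaLaw (ha i)
  have hm : Measurable fun (D : Fin (n + 1) → ℝ) (i : Fin n) =>
      D (Fin.succ i) / ∑ j : Fin n, D (Fin.succ j) := by fun_prop
  refine Measure.ext_of_lintegral _ fun f hf => ?_
  have hfm : Measurable fun D : Fin (n + 1) → ℝ =>
      f fun i => D (Fin.succ i) / ∑ j : Fin n, D (Fin.succ j) := hf.comp hm
  rw [lintegral_map hf hm, lintegral_dirichletLaw _ hfm, lintegral_dirichletLaw _ hf]
  have hnn : ∀ᵐ g ∂Measure.pi fun i => gammaLaw (a i), ∀ i, 0 ≤ g i :=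
    ae_all_iff.2 fun i => (Measure.quasiMeasurePreserving_eval _ i).ae (ae_gammaLaw_nonneg (a i))
  rw [lintegral_congr_ae (g := fun D => f fun i => D (Fin.succ i) / ∑ j : Fin n, D (Fin.succ j)),
    lintegral_pi_insertNth _ 0 hfm]
  · simp
  filter_upwards [hnn] with g hg
  congr 1
  ext i
  -- The sum cancels unless it vanishes, and then all coordinates are `0`.
  by_cases hS : ∑ j, g j = 0
  · have : ∀ j, g j = 0 := by simpa [Finset.sum_eq_zero_iff_of_nonneg, hg] using hS
    simp [this]
  · rw [← Finset.sum_div, div_div_div_cancel_right₀ hS]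

theorem dirichletLaw_single {k : ℕ} (j : Fin k) {θ : ℝ} (hθ : 0 < θ) :
    dirichletLaw (Pi.single j θ) = Measure.dirac (Pi.single j 1) := by
  have h0 : ∀ i, 0 ≤ (Pi.single j θ : Fin k → ℝ) i := fun i => by
    by_cases h : i = j
    · subst h; simpa using hθ.le
    · simp [h]
  have := fun i => isProbabilityMeasure_gammaLaw (h0 i)
  have hz : ∀ᵐ g ∂Measure.pi fun i => gammaLaw ((Pi.single j θ : Fin k → ℝ) i),
      ∀ i, i ≠ j → g i = 0 := by
    refine ae_all_iff.2 fun i => (Measure.quasiMeasurePreserving_eval _ i).ae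
      (p := fun x => i ≠ j → x = 0) ?_
    by_cases h : i = j
    · simp [h]
    · simp only [Pi.single_eq_of_ne h, gammaLaw, if_true]
      exact (ae_dirac_iff (p := fun x : ℝ => i ≠ j → x = 0)
        (by simp [h])).2 fun _ => rfl
  have hj : ∀ᵐ g ∂Measure.pi fun i => gammaLaw ((Pi.single j θ : Fin k → ℝ) i), 0 < g j :=
    (Measure.quasiMeasurePreserving_eval _ j).ae (by simpa using ae_gammaLaw_pos hθ)
  rw [dirichletLaw, Measure.map_congr (g := fun _ => Pi.single j 1), Measure.map_const,
    measure_univ, one_smul]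
  filter_upwards [hz, hj] with g hg hgj
  ext i
  rw [Finset.sum_eq_single j (fun i _ hi => hg i hi) (by simp)]
  by_cases h : i = j
  · subst h; simp [hgj.ne']
  · simp [h, hg i h]

theorem dirichletLaw_ae_ne_zero {k : ℕ} {a : Fin k → ℝ} (ha : ∀ i, 0 ≤ a i) {j : Fin k}
    (hj : 0 < a j) : ∀ᵐ D ∂dirichletLaw a, D j ≠ 0 := by
  have := fun i => isProbabilityMeasure_gammaLaw (ha i)
  have hnn : ∀ᵐ g ∂Measure.pi fun i => gammaLaw (a i), ∀ i, 0 ≤ g i :=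
    ae_all_iff.2 fun i => (Measure.quasiMeasurePreserving_eval _ i).ae (ae_gammaLaw_nonneg (a i))
  have hjp : ∀ᵐ g ∂Measure.pi fun i => gammaLaw (a i), 0 < g j :=
    (Measure.quasiMeasurePreserving_eval _ j).ae (ae_gammaLaw_pos hj)
  have hset : MeasurableSet {D : Fin k → ℝ | D j ≠ 0} :=
    (measurable_pi_apply j (measurableSet_singleton 0)).compl
  rw [dirichletLaw, ae_map_iff (measurable_div_sum k).aemeasurable hset]
  filter_upwards [hnn, hjp] with g hg hgj
  exact (div_pos hgj (Finset.sum_pos' (fun i _ => hg i) ⟨j, Finset.mem_univ _, hgj⟩)).ne'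

/-! ### Dirichlet processes -/

theorem sum_measureReal_partition {k : ℕ} {C : Fin k → Set ℝ≥0} (hC : ∀ i, MeasurableSet (C i))
    (hd : Pairwise fun i j => Disjoint (C i) (C j)) (hU : ⋃ i, C i = Set.univ)
    (F : Measure ℝ≥0) [IsProbabilityMeasure F] : ∑ i, F.real (C i) = 1 := by
  rw [← measureReal_iUnion_fintype hd hC, hU, probReal_univ]

theorem mul_pi_single_one {k : ℕ} (c : ℝ) (i j : Fin k) :
    c * (Pi.single j 1 : Fin k → ℝ) i = (Pi.single j c : Fin k → ℝ) i := by
  by_cases h : i = j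
  · subst h; simp
  · simp [h]

theorem dirac_real_partition {k : ℕ} {C : Fin k → Set ℝ≥0} (hC : ∀ i, MeasurableSet (C i))
    (hd : Pairwise fun i j => Disjoint (C i) (C j)) {x : ℝ≥0} {j : Fin k} (hj : x ∈ C j)
    (i : Fin k) : (Measure.dirac x).real (C i) = (Pi.single j 1 : Fin k → ℝ) i := by
  by_cases h : i = j
  · subst h; simp [measureReal_def, Measure.dirac_apply' _ (hC i), hj]
  · have : x ∉ C i := fun hx => Set.disjoint_left.1 (hd h) hx hj
    simp [measureReal_def, Measure.dirac_apply' _ (hC i), this, h]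

namespace IsDirichletProcess

variable {Ω Ω' : Type*} [MeasurableSpace Ω] [MeasurableSpace Ω'] {θ : ℝ} {F : Measure ℝ≥0}
  {P : Ω → Measure ℝ≥0} {μ : Measure Ω} {P' : Ω' → Measure ℝ≥0} {μ' : Measure Ω'}

theorem measurable_real (h : IsDirichletProcess θ F P μ) {C : Set ℝ≥0} (hC : MeasurableSet C) :
    Measurable fun ω => (P ω).real C :=
  ((Measure.measurable_coe hC).comp h.measurable).ennreal_toReal

/-- The constant process `δ_x` is a Dirichlet process with base law `δ_x`. -/
theorem const (hθ : 0 < θ) (x : ℝ≥0) [IsProbabilityMeasure μ] :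
    IsDirichletProcess θ (Measure.dirac x) (fun _ => Measure.dirac x) μ where
  measurable := measurable_const
  isProbabilityMeasure := ae_of_all _ fun _ => inferInstance
  map_partition k C hC hd hU := by
    obtain ⟨j, hj⟩ := Set.mem_iUnion.1 (hU ▸ Set.mem_univ x)
    have e := dirac_real_partition hC hd hj
    simp only [e, mul_pi_single_one]
    rw [dirichletLaw_single j hθ, Measure.map_const, measure_univ, one_smul]

/-- If `P` is a Dirichlet process with parameter measure `θ • F` and `B` is an independent
beta `(θ, b)` variable, then `B • P + (1 - B) • δ_x` is a Dirichlet process with parameter measure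
`θ • F + b • δ_x`. -/
theorem smul_add_dirac [IsProbabilityMeasure μ] [IsProbabilityMeasure F] (hθ : 0 < θ)
    (h : IsDirichletProcess θ F P μ) {b : ℝ} (hb : 0 ≤ b) (x : ℝ≥0) {F' : Measure ℝ≥0}
    (hF' : ∀ C, MeasurableSet C →
      (θ + b) * F'.real C = θ * F.real C + b * (Measure.dirac x).real C) :
    IsDirichletProcess (θ + b) F'
      (fun p : Ω × ℝ => ENNReal.ofReal p.2 • P p.1 + ENNReal.ofReal (1 - p.2) • Measure.dirac x)
      (μ.prod (betaLaw θ b)) := by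
  have := isProbabilityMeasure_betaLaw hθ hb
  have hPp : ∀ᵐ p ∂μ.prod (betaLaw θ b), IsProbabilityMeasure (P p.1) :=
    Measure.quasiMeasurePreserving_fst.ae h.isProbabilityMeasure
  have hB : ∀ᵐ p ∂μ.prod (betaLaw θ b), p.2 ∈ Set.Icc (0 : ℝ) 1 :=
    Measure.quasiMeasurePreserving_snd.ae (ae_betaLaw_mem_Icc θ b)
  refine ⟨?_, ?_, fun k C hC hd hU => ?_⟩
  · refine Measure.measurable_of_measurable_coe _ fun s hs => ?_
    have := (Measure.measurable_coe hs).comp h.measurable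
    simp only [Measure.add_apply, Measure.smul_apply, smul_eq_mul]
    have h1 : Measurable fun p : Ω × ℝ => P p.1 s := this.comp measurable_fst
    fun_prop
  · filter_upwards [hPp, hB] with p hp hpB
    constructor
    simp only [Measure.add_apply, Measure.smul_apply, smul_eq_mul, measure_univ, mul_one]
    rw [← ENNReal.ofReal_add hpB.1 (by linarith [hpB.2])]
    simp
  obtain ⟨j, hj⟩ := Set.mem_iUnion.1 (hU ▸ Set.mem_univ x)
  have e := dirac_real_partition hC hd hj
  have hsum : ∑ i, θ * F.real (C i) = θ := by
    rw [← Finset.mul_sum, sum_measureReal_partition hC hd hU, mul_one]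
  have hv : Measurable fun ω i => (P ω).real (C i) :=
    measurable_pi_iff.2 fun i => h.measurable_real (hC i)
  have hsi := measurable_pi_single_real j
  have hT : Measurable fun p : (Fin k → ℝ) × ℝ => p.2 • p.1 + Pi.single j (1 - p.2) :=
    Measurable.add (by fun_prop) (hsi.comp (by fun_prop))
  have key := dirichletLaw_add_single (a := fun i => θ * F.real (C i))
    (fun i => by positivity) (by rw [hsum]; exact hθ) hb j
  have eF : (fun i => (θ + b) * F'.real (C i))
      = (fun i => θ * F.real (C i)) + (Pi.single j b : Fin k → ℝ) := by
    ext i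
    rw [hF' _ (hC i), e i, mul_pi_single_one]
    rfl
  rw [eF, ← key, hsum, ← h.map_partition k C hC hd hU]
  conv_rhs => rw [← Measure.map_id (μ := betaLaw θ b)]
  rw [Measure.map_prod_map _ _ hv measurable_id, Measure.map_map hT (hv.prodMap measurable_id)]
  refine Measure.map_congr ?_
  filter_upwards [hPp, hB] with p hp hpB
  ext i
  have h1 : 0 ≤ 1 - p.2 := by linarith [hpB.2]
  simp only [Function.comp, Prod.map, id, Pi.add_apply, Pi.smul_apply, smul_eq_mul]
  rw [measureReal_add_apply (ENNReal.mul_ne_top ENNReal.ofReal_ne_top (measure_ne_top _ _))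
    (ENNReal.mul_ne_top ENNReal.ofReal_ne_top (measure_ne_top _ _)), measureReal_ennreal_smul_apply, measureReal_ennreal_smul_apply, e i,
    ENNReal.toReal_ofReal hpB.1, ENNReal.toReal_ofReal h1, mul_pi_single_one]

/-- A Dirichlet process conditioned on a set `S` of positive mass is a Dirichlet process, whose
parameter measure is the restriction to `S`. -/
theorem cond [IsProbabilityMeasure μ] [IsProbabilityMeasure F] (h : IsDirichletProcess θ F P μ)
    (hθ : 0 < θ) {S : Set ℝ≥0} (hS : MeasurableSet S) (hFS : 0 < F.real S) {A : ℝ}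
    {F' : Measure ℝ≥0}
    (hF' : ∀ C, MeasurableSet C → A * F'.real C = θ * F.real (S ∩ C)) :
    IsDirichletProcess A F' (fun ω => ProbabilityTheory.cond (P ω) S) μ := by
  have hpos : ∀ᵐ ω ∂μ, (P ω).real S ≠ 0 := by
    have hm := h.map_partition 2 ![Sᶜ, S] (by simp [Fin.forall_fin_two, hS, hS.compl])
      (by
        intro i j hij
        fin_cases i <;> fin_cases j <;> simp_all [disjoint_compl_left, disjoint_compl_right])
      (by rw [Set.eq_univ_iff_forall]; intro x; simp [Fin.exists_fin_two, em'])
    have hne := dirichletLaw_ae_ne_zero (a := fun i => θ * F.real (![Sᶜ, S] i))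
      (fun i => by positivity) (j := 1) (mul_pos hθ hFS)
    rw [← hm] at hne
    have hv : Measurable fun ω (i : Fin 2) => (P ω).real (![Sᶜ, S] i) :=
      measurable_pi_iff.2 fun i => h.measurable_real (by fin_cases i <;> simp [hS, hS.compl])
    exact ae_of_ae_map hv.aemeasurable hne
  refine ⟨?_, ?_, fun k C hC hd hU => ?_⟩
  · refine Measure.measurable_of_measurable_coe _ fun s hs => ?_
    simp only [cond_apply hS]
    exact ((Measure.measurable_coe hS).comp h.measurable).inv.mul
      ((Measure.measurable_coe (hS.inter hs)).comp h.measurable)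
  · filter_upwards [hpos, h.isProbabilityMeasure] with ω hω hP
    exact cond_isProbabilityMeasure fun h0 => hω (by simp [measureReal_def, h0])
  -- The partition of `S` induced by `C`, completed by `Sᶜ`.
  set C' : Fin (k + 1) → Set ℝ≥0 := Fin.cons Sᶜ fun i => S ∩ C i with hC'
  have hC'm : ∀ i, MeasurableSet (C' i) :=
    Fin.cases (by simpa [hC'] using hS.compl) fun i => by simpa [hC'] using hS.inter (hC i)
  have hdS : ∀ i, Disjoint Sᶜ (S ∩ C i) := fun i =>
    disjoint_compl_left.mono_right Set.inter_subset_left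
  have hm := h.map_partition (k + 1) C' hC'm
    (by
      intro i j
      refine Fin.cases ?_ (fun i => ?_) i <;> refine Fin.cases ?_ (fun j => ?_) j
      · simp
      · simpa [hC'] using fun _ => hdS j
      · simpa [hC'] using (hdS i).symm
      · intro hij
        simpa [hC'] using (hd (fun e => hij (by rw [e]))).mono Set.inter_subset_right
          Set.inter_subset_right)
    (by
      rw [Set.eq_univ_iff_forall]
      intro x
      have hx : x ∈ ⋃ i, C i := hU ▸ Set.mem_univ x
      simp only [Set.mem_iUnion, Fin.exists_fin_succ, hC', Fin.cons_zero, Fin.cons_succ,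
        Set.mem_inter_iff, Set.mem_compl_iff, exists_and_left] at hx ⊢
      tauto)
  have hv : Measurable fun ω i => (P ω).real (C' i) :=
    measurable_pi_iff.2 fun i => h.measurable_real (hC'm i)
  have key := dirichletLaw_map_succ_div_sum (a := fun i => θ * F.real (C' i))
    fun i => by positivity
  rw [← hm, Measure.map_map (by fun_prop) hv] at key
  have e : (fun i => A * F'.real (C i)) = fun i : Fin k => θ * F.real (C' i.succ) := by
    ext i
    rw [hF' _ (hC i)]
    simp [hC']
  rw [e, ← key]
  refine Measure.map_congr ?_
  filter_upwards [h.isProbabilityMeasure] with ω hP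
  have hsum : ∑ i, (P ω).real (S ∩ C i) = (P ω).real S := by
    rw [← measureReal_iUnion_fintype
      (fun i j hij => (hd hij).mono Set.inter_subset_right Set.inter_subset_right)
      (fun i => hS.inter (hC i)), ← Set.inter_iUnion, hU, Set.inter_univ]
  ext i
  simp only [Function.comp, hC', Fin.cons_succ, hsum]
  rw [measureReal_def, cond_apply hS, ENNReal.toReal_mul, ENNReal.toReal_inv, div_eq_inv_mul]
  rfl

/-- The integral of a simple function is determined by the masses of its level sets, whose joint law
is a Dirichlet distribution. -/
theorem map_simpleFunc_lintegral (h : IsDirichletProcess θ F P μ) (s : SimpleFunc ℝ≥0 ℝ≥0∞) :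
    μ.map (fun ω => s.lintegral (P ω))
      = (dirichletLaw fun i => θ * F.real (s ⁻¹' {(s.range.equivFin.symm i : ℝ≥0∞)})).map
        fun v => ∑ i, (s.range.equivFin.symm i : ℝ≥0∞) * ENNReal.ofReal (v i) := by
  let e := s.range.equivFin.symm
  let C : Fin s.range.card → Set ℝ≥0 := fun i => s ⁻¹' {(e i : ℝ≥0∞)}
  have hC : ∀ i, MeasurableSet (C i) := fun i => s.measurableSet_preimage _
  have hd : Pairwise fun i j => Disjoint (C i) (C j) := fun i j hij =>
    Disjoint.preimage _ (by
      simpa [Subtype.ext_iff] using fun he => hij (e.injective (Subtype.ext he)))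
  have hU : ⋃ i, C i = Set.univ := by
    rw [Set.eq_univ_iff_forall]
    intro x
    refine Set.mem_iUnion.2 ⟨e.symm ⟨s x, s.mem_range_self x⟩, ?_⟩
    simp [C]
  have hT : Measurable fun v : Fin s.range.card → ℝ =>
      ∑ i, (e i : ℝ≥0∞) * ENNReal.ofReal (v i) := by fun_prop
  change _ = (dirichletLaw fun i => θ * F.real (C i)).map
    fun v => ∑ i, (e i : ℝ≥0∞) * ENNReal.ofReal (v i)
  rw [← h.map_partition _ C hC hd hU,
    Measure.map_map hT (measurable_pi_iff.2 fun i => h.measurable_real (hC i))]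
  refine Measure.map_congr ?_
  filter_upwards [h.isProbabilityMeasure] with ω hP
  have hr : ∀ i, ENNReal.ofReal ((P ω).real (C i)) = P ω (C i) := fun i => ofReal_measureReal
  simp only [Function.comp, hr]
  rw [SimpleFunc.lintegral, ← Finset.sum_coe_sort, ← e.sum_comp]

theorem measurable_lintegral (h : IsDirichletProcess θ F P μ) {f : ℝ≥0 → ℝ≥0∞}
    (hf : Measurable f) : Measurable fun ω => ∫⁻ x, f x ∂P ω :=
  (Measure.measurable_lintegral hf).comp h.measurable

theorem map_lintegral_Iic [IsProbabilityMeasure μ] (h : IsDirichletProcess θ F P μ)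
    {f : ℝ≥0 → ℝ≥0∞} (hf : Measurable f) (t : ℝ≥0∞) :
    μ.map (fun ω => ∫⁻ x, f x ∂P ω) (Set.Iic t)
      = ⨅ n, μ.map (fun ω => (SimpleFunc.eapprox f n).lintegral (P ω)) (Set.Iic t) := by
  have hs : ∀ n, Measurable fun ω => (SimpleFunc.eapprox f n).lintegral (P ω) := by
    intro n
    simp only [← SimpleFunc.lintegral_eq_lintegral]
    exact h.measurable_lintegral (SimpleFunc.measurable _)
  have e : (fun ω => ∫⁻ x, f x ∂P ω) ⁻¹' Set.Iic t
      = ⋂ n, (fun ω => (SimpleFunc.eapprox f n).lintegral (P ω)) ⁻¹' Set.Iic t := by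
    ext ω
    simp [lintegral_eq_iSup_eapprox_lintegral hf]
  rw [Measure.map_apply (h.measurable_lintegral hf) measurableSet_Iic, e, Antitone.measure_iInter]
  · exact iInf_congr fun n => (Measure.map_apply (hs n) measurableSet_Iic).symm
  · exact fun m n hmn ω hω => (SimpleFunc.lintegral_mono
      (SimpleFunc.monotone_eapprox f hmn) le_rfl).trans hω
  · exact fun n => (hs n measurableSet_Iic).nullMeasurableSet
  · exact ⟨0, measure_ne_top _ _⟩

/-- The law of `∫ f dP` for a Dirichlet process `P` depends only on the parameters. It is
determined by the laws of the integrals of simple functions increasing to `f`. -/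
theorem map_lintegral_eq [IsProbabilityMeasure μ] [IsProbabilityMeasure μ']
    (h : IsDirichletProcess θ F P μ) (h' : IsDirichletProcess θ F P' μ') {f : ℝ≥0 → ℝ≥0∞}
    (hf : Measurable f) :
    μ.map (fun ω => ∫⁻ x, f x ∂P ω) = μ'.map (fun ω => ∫⁻ x, f x ∂P' ω) := by
  have := Measure.isProbabilityMeasure_map (μ := μ) (h.measurable_lintegral hf).aemeasurable
  refine Measure.ext_of_Iic _ _ fun t => ?_
  rw [h.map_lintegral_Iic hf, h'.map_lintegral_Iic hf]
  simp_rw [h.map_simpleFunc_lintegral, h'.map_simpleFunc_lintegral]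

end IsDirichletProcess

/-! ### Dirichlet means -/

theorem map_ofReal_mul_eq {Ω : Type*} [MeasurableSpace Ω] {μ : Measure Ω} [IsProbabilityMeasure μ]
    {ρ : Measure ℝ} {B : Ω → ℝ} {M : Ω → ℝ≥0∞} (hB : HasLaw B ρ μ) (hM : AEMeasurable M μ)
    (hBM : IndepFun B M μ) :
    μ.map (fun ω => ENNReal.ofReal (B ω) * M ω)
      = (ρ.prod (μ.map M)).map fun p => ENNReal.ofReal p.1 * p.2 := by
  rw [← hB.map_eq, ← (indepFun_iff_map_prod_eq_prod_map_map hB.aemeasurable hM).1 hBM,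
    AEMeasurable.map_map_of_aemeasurable (by fun_prop) (hB.aemeasurable.prodMk hM)]
  rfl

/-- The law of `X * Y` is `σ • F_X + (1 - σ) • δ₀` for a Bernoulli variable `Y` independent of `X`. -/
theorem map_mul_bernoulli_real {Ω : Type*} [MeasurableSpace Ω] {μ : Measure Ω}
    [IsProbabilityMeasure μ] {σ : ℝ} (hσ : 0 ≤ σ) (hσ1 : σ ≤ 1) {X Y : Ω → ℝ≥0}
    (hX : AEMeasurable X μ) (hY : HasLaw Y (bernoulliMeasure (1 : ℝ≥0) 0 ⟨σ, hσ, hσ1⟩) μ)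
    (hXY : IndepFun X Y μ) (C : Set ℝ≥0) :
    (μ.map fun ω => X ω * Y ω).real C
      = σ * (μ.map X).real C + (1 - σ) * (Measure.dirac (0 : ℝ≥0)).real C := by
  have := Measure.isProbabilityMeasure_map hX
  have h : μ.map (fun ω => X ω * Y ω)
      = ENNReal.ofReal σ • μ.map X + ENNReal.ofReal (1 - σ) • Measure.dirac 0 := by
    have e : μ.map (fun ω => X ω * Y ω)
        = ((μ.map X).prod (μ.map Y)).map fun p => p.1 * p.2 := by
      rw [← (indepFun_iff_map_prod_eq_prod_map_map hX hY.aemeasurable).1 hXY,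
        AEMeasurable.map_map_of_aemeasurable (by fun_prop) (hX.prodMk hY.aemeasurable)]
      rfl
    refine Measure.ext_of_lintegral _ fun f hf => ?_
    have hb : ∀ g : ℝ≥0 → ℝ≥0∞, Measurable g →
        ∫⁻ y, g y ∂μ.map Y = ENNReal.ofReal σ * g 1 + ENNReal.ofReal (1 - σ) * g 0 := by
      intro g hg
      rw [hY.map_eq, bernoulliMeasure_def, lintegral_add_measure, lintegral_smul_measure,
        lintegral_smul_measure, lintegral_dirac' _ hg, lintegral_dirac' _ hg]
      have h1 : unitInterval.toNNReal ⟨σ, hσ, hσ1⟩ = σ.toNNReal := by ext; simp [hσ]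
      have h2 : unitInterval.toNNReal (unitInterval.symm ⟨σ, hσ, hσ1⟩) = (1 - σ).toNNReal := by
        ext; simp [hσ1]
      rw [h1, h2]
      rfl
    have : IsProbabilityMeasure (μ.map Y) := Measure.isProbabilityMeasure_map hY.aemeasurable
    rw [e, lintegral_map hf (by fun_prop), lintegral_prod _ (by fun_prop)]
    simp_rw [fun x => hb (fun y => f (x * y)) (by fun_prop)]
    rw [lintegral_add_left (by fun_prop), lintegral_const_mul _ (by fun_prop),
      lintegral_add_measure, lintegral_smul_measure, lintegral_smul_measure,
      lintegral_dirac' _ hf]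
    simp
  rw [h, measureReal_add_apply (ENNReal.mul_ne_top ENNReal.ofReal_ne_top (measure_ne_top _ _))
    (ENNReal.mul_ne_top ENNReal.ofReal_ne_top (measure_ne_top _ _)),
    measureReal_ennreal_smul_apply, measureReal_ennreal_smul_apply,
    ENNReal.toReal_ofReal hσ, ENNReal.toReal_ofReal (by linarith)]

namespace IsDirichletMean

variable {Ω Ω' : Type*} [MeasurableSpace Ω] [MeasurableSpace Ω'] {a b θ : ℝ} {F F' : Measure ℝ≥0}
  {M : Ω → ℝ≥0∞} {μ : Measure Ω} {M' : Ω' → ℝ≥0∞} {μ' : Measure Ω'}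

/-- Dirichlet means with the same parameters have the same law. -/
theorem identDistrib (h : IsDirichletMean θ F M μ) (h' : IsDirichletMean θ F M' μ') :
    IdentDistrib M M' μ μ' := by
  obtain ⟨Ω₁, _, μ₁, P, hμ₁, hP, hM⟩ := h
  obtain ⟨Ω₂, _, μ₂, Q, hμ₂, hQ, hM'⟩ := h'
  exact (hM.trans ⟨hM.aemeasurable_snd, hM'.aemeasurable_snd,
    hP.map_lintegral_eq hQ (by fun_prop)⟩).trans hM'.symm

theorem congr (h : IsDirichletMean θ F M μ) (hMM' : IdentDistrib M' M μ' μ) :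
    IsDirichletMean θ F M' μ' := by
  obtain ⟨Ω₁, _, μ₁, P, hμ₁, hP, hM⟩ := h
  exact ⟨Ω₁, _, μ₁, P, hμ₁, hP, hMM'.trans hM⟩

theorem aemeasurable (h : IsDirichletMean θ F M μ) : AEMeasurable M μ := by
  obtain ⟨_, _, _, _, _, _, hM⟩ := h
  exact hM.aemeasurable_fst

theorem snd (h : IsDirichletMean θ F M μ) [IsProbabilityMeasure μ] (ρ : Measure ℝ)
    [IsProbabilityMeasure ρ] :
    IsDirichletMean θ F Prod.snd (ρ.prod (μ.map M)) := by
  have := Measure.isProbabilityMeasure_map h.aemeasurable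
  exact h.congr ⟨by fun_prop, h.aemeasurable, Measure.snd_prod⟩

theorem dirac (hθ : 0 < θ) (x : ℝ≥0) [IsProbabilityMeasure μ] :
    IsDirichletMean θ (Measure.dirac x) (fun _ : Ω => (x : ℝ≥0∞)) μ :=
  ⟨Unit, inferInstance, Measure.dirac (), fun _ => Measure.dirac x, inferInstance,
    .const hθ x, by fun_prop, by fun_prop, by
      simp only [lintegral_dirac, Measure.map_const, measure_univ]⟩

/-- The Dirichlet mean for the parameter measure `a • F + b • δ₀` is that for `a • F` times an
independent beta `(a, b)` variable. -/
theorem beta_mul [IsProbabilityMeasure μ] [IsProbabilityMeasure F] (ha : 0 < a) (hb : 0 ≤ b)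
    (hF' : ∀ C, MeasurableSet C →
      (a + b) * F'.real C = a * F.real C + b * (Measure.dirac (0 : ℝ≥0)).real C)
    (h : IsDirichletMean a F M μ) {B : Ω → ℝ} (hB : HasLaw B (betaLaw a b) μ)
    (hBM : IndepFun B M μ) :
    IsDirichletMean (a + b) F' (fun ω => ENNReal.ofReal (B ω) * M ω) μ := by
  have hM := h.aemeasurable
  obtain ⟨Ω₁, _, μ₁, P, hμ₁, hP, hMP⟩ := h
  have := isProbabilityMeasure_betaLaw ha hb
  have hI := hP.measurable_lintegral (f := fun x => (x : ℝ≥0∞)) (by fun_prop)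
  have e : (fun p : Ω₁ × ℝ => ∫⁻ x, (x : ℝ≥0∞)
      ∂(ENNReal.ofReal p.2 • P p.1 + ENNReal.ofReal (1 - p.2) • Measure.dirac (0 : ℝ≥0)))
      = fun p => ENNReal.ofReal p.2 * ∫⁻ x, (x : ℝ≥0∞) ∂P p.1 := by
    ext p
    simp [lintegral_add_measure, lintegral_smul_measure]
  refine ⟨Ω₁ × ℝ, inferInstance, μ₁.prod (betaLaw a b), _, inferInstance,
    hP.smul_add_dirac ha hb 0 hF', ?_⟩
  rw [e]
  have hm : Measurable fun p : Ω₁ × ℝ => ENNReal.ofReal p.2 * ∫⁻ x, (x : ℝ≥0∞) ∂P p.1 :=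
    (by fun_prop : Measurable fun p : Ω₁ × ℝ => ENNReal.ofReal p.2).mul (hI.comp measurable_fst)
  refine ⟨hB.aemeasurable.ennreal_ofReal.mul hM, hm.aemeasurable, ?_⟩
  rw [map_ofReal_mul_eq hB hM hBM, hMP.map_eq, ← Measure.prod_swap]
  conv_lhs => rw [← Measure.map_id (μ := betaLaw a b)]
  rw [Measure.map_prod_map _ _ hI measurable_id, Measure.map_map (by fun_prop) measurable_swap,
    Measure.map_map (by fun_prop) (by fun_prop)]
  rfl

/-- A Dirichlet mean for `a • F` exists if there is one for `a • F + b • δ₀`. The process is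
conditioned on the complement of `0`, and then mixed with `δ₀` to restore the atom of `F` at `0`. -/
theorem exists_of_mixture [IsProbabilityMeasure F] [IsProbabilityMeasure F'] (ha : 0 < a)
    (hb : 0 ≤ b)
    (hF' : ∀ C, MeasurableSet C →
      (a + b) * F'.real C = a * F.real C + b * (Measure.dirac (0 : ℝ≥0)).real C)
    (h : IsDirichletMean (a + b) F' M' μ') :
    ∃ (Ω : Type) (_ : MeasurableSpace Ω) (μ : Measure Ω) (M : Ω → ℝ≥0∞),
      IsProbabilityMeasure μ ∧ IsDirichletMean a F M μ := by
  have hS : MeasurableSet ({0}ᶜ : Set ℝ≥0) := (measurableSet_singleton 0).compl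
  have hsplit : ∀ C, MeasurableSet C → F.real C
      = F.real ({0}ᶜ ∩ C) + F.real {0} * (Measure.dirac (0 : ℝ≥0)).real C := by
    intro C hC
    rw [← measureReal_inter_add_sdiff (s := C) (measurableSet_singleton (0 : ℝ≥0)), add_comm]
    congr 1
    · rw [Set.sdiff_eq, Set.inter_comm]
    · by_cases h0 : (0 : ℝ≥0) ∈ C
      · simp [measureReal_def, Measure.dirac_apply' _ hC, h0]
      · simp [measureReal_def, Measure.dirac_apply' _ hC, h0]
  have hsum : F.real {0}ᶜ + F.real {0} = 1 := by
    rw [add_comm, probReal_add_probReal_compl (measurableSet_singleton (0 : ℝ≥0))]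
  -- If `F = δ₀`, then there is no mass to condition on, and the constant process serves.
  rcases (measureReal_nonneg (μ := F) (s := {0}ᶜ)).eq_or_lt with h0 | hpos
  · have hF : F = Measure.dirac 0 := by
      refine Measure.ext fun C hC => ?_
      have h1 : F.real ({0}ᶜ ∩ C) = 0 :=
        le_antisymm (h0 ▸ measureReal_mono Set.inter_subset_left) measureReal_nonneg
      rw [← h0, zero_add] at hsum
      rw [← ofReal_measureReal (μ := F), hsplit C hC, h1, hsum, zero_add, one_mul,
        ofReal_measureReal]
    rw [hF]
    exact ⟨Unit, inferInstance, Measure.dirac (), _, inferInstance, .dirac ha 0⟩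
  obtain ⟨Ω₁, _, μ₁, P, hμ₁, hP, -⟩ := h
  have hF'S : ∀ C, MeasurableSet C →
      (a + b) * F'.real ({0}ᶜ ∩ C) = a * F.real ({0}ᶜ ∩ C) := by
    intro C hC
    rw [hF' _ (hS.inter hC)]
    simp [measureReal_def, Measure.dirac_apply' _ (hS.inter hC)]
  have hF'pos : 0 < F'.real {0}ᶜ := by
    have := hF'S Set.univ .univ
    simp only [Set.inter_univ] at this
    exact pos_of_mul_pos_right (this ▸ mul_pos ha hpos) (by positivity)
  have hcond : ∀ C, MeasurableSet C →
      a * F.real {0}ᶜ * (ProbabilityTheory.cond F {0}ᶜ).real C = a * F.real ({0}ᶜ ∩ C) := by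
    intro C hC
    rw [measureReal_def (μ := F[|_]), cond_apply hS, ENNReal.toReal_mul, ENNReal.toReal_inv]
    simp only [← measureReal_def]
    field_simp
  have : IsProbabilityMeasure (ProbabilityTheory.cond F {0}ᶜ) :=
    cond_isProbabilityMeasure fun h => hpos.ne' (by simp [measureReal_def, h])
  have hQ := hP.cond (by positivity) hS hF'pos (A := a * F.real {0}ᶜ)
    (F' := ProbabilityTheory.cond F {0}ᶜ) fun C hC => by rw [hcond C hC, hF'S C hC]
  have hab : a * F.real {0}ᶜ + a * F.real {0} = a := by rw [← mul_add, hsum, mul_one]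
  have hR := hQ.smul_add_dirac (mul_pos ha hpos) (b := a * F.real {0}) (by positivity) 0 (F' := F)
    fun C hC => by rw [hab, hcond C hC, hsplit C hC]; ring
  rw [hab] at hR
  have := isProbabilityMeasure_betaLaw (mul_pos ha hpos) (b := a * F.real {0}) (by positivity)
  have hm := hR.measurable_lintegral (f := fun x => (x : ℝ≥0∞)) (by fun_prop)
  exact ⟨Ω₁ × ℝ, inferInstance, _, _, inferInstance, Ω₁ × ℝ, inferInstance, _, _, inferInstance, hR,
    .refl hm.aemeasurable⟩

/-- The extra beta factor in the mean for `a • F + b • δ₀` turns a gamma `(a + b)` variable into a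
gamma `(a)` variable. -/
theorem map_gamma_mul_eq [IsProbabilityMeasure μ] [IsProbabilityMeasure μ']
    [IsProbabilityMeasure F] (ha : 0 < a) (hb : 0 ≤ b)
    (hF' : ∀ C, MeasurableSet C →
      (a + b) * F'.real C = a * F.real C + b * (Measure.dirac (0 : ℝ≥0)).real C)
    (h : IsDirichletMean a F M μ) (h' : IsDirichletMean (a + b) F' M' μ') :
    ((gammaLaw a).prod (μ.map M)).map (fun p => ENNReal.ofReal p.1 * p.2)
      = ((gammaLaw (a + b)).prod (μ'.map M')).map (fun p => ENNReal.ofReal p.1 * p.2) := by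
  have := isProbabilityMeasure_betaLaw ha hb
  have := isProbabilityMeasure_gammaLaw ha.le
  have := isProbabilityMeasure_gammaLaw hb
  have := Measure.isProbabilityMeasure_map h.aemeasurable
  have := Measure.isProbabilityMeasure_map h'.aemeasurable
  have hB : HasLaw Prod.fst (betaLaw a b) ((betaLaw a b).prod (μ.map M)) :=
    ⟨by fun_prop, Measure.fst_prod⟩
  have hm' : μ'.map M' = ((betaLaw a b).prod (μ.map M)).map fun p => ENNReal.ofReal p.1 * p.2 :=
    (h'.identDistrib ((h.snd (betaLaw a b)).beta_mul ha hb hF' hB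
      (indepFun_prod measurable_id measurable_id))).map_eq
  refine Measure.ext_of_lintegral _ fun f hf => ?_
  rw [lintegral_map hf (by fun_prop), lintegral_map hf (by fun_prop),
    lintegral_prod _ (by fun_prop), lintegral_prod _ (by fun_prop)]
  have e : ∀ g, 0 ≤ g → ∫⁻ y, f (ENNReal.ofReal g * y) ∂μ'.map M'
      = ∫⁻ u, ∫⁻ y, f (ENNReal.ofReal (g * u) * y) ∂μ.map M ∂betaLaw a b := by
    intro g hg
    rw [hm', lintegral_map (by fun_prop) (by fun_prop), lintegral_prod _ (by fun_prop)]
    simp only [ENNReal.ofReal_mul hg, mul_assoc]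
  rw [lintegral_congr_ae (μ := gammaLaw (a + b)) (by
    filter_upwards [ae_gammaLaw_nonneg (a + b)] with g hg using e g hg)]
  rw [lintegral_gammaLaw_betaLaw ha hb
    (f := fun p => ∫⁻ y, f (ENNReal.ofReal p.1 * y) ∂μ.map M)
    (Measurable.lintegral_prod_right'
      (f := fun q : (ℝ × ℝ) × ℝ≥0∞ => f (ENNReal.ofReal q.1.1 * q.2)) (by fun_prop))]
  simp

end IsDirichletMean

/-- The class `GGC(θ, F)` contains exactly the law obtained from the Dirichlet mean, provided the
latter exists. -/
theorem isGGC_iff {θ : ℝ} (hθ : 0 < θ) {F : Measure ℝ≥0} {ν : Measure ℝ≥0∞} :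
    IsGGC θ F ν ↔ ∃ (Ω : Type) (_ : MeasurableSpace Ω) (μ : Measure Ω) (M : Ω → ℝ≥0∞),
      IsProbabilityMeasure μ ∧ IsDirichletMean θ F M μ ∧
      ν = ((gammaLaw θ).prod (μ.map M)).map (fun p => ENNReal.ofReal p.1 * p.2) := by
  have := isProbabilityMeasure_gammaLaw hθ.le
  constructor
  · rintro ⟨Ω, _, μ, G, M, hμ, hG, hM, hGM, hν⟩
    exact ⟨Ω, _, μ, M, hμ, hM, by rw [← hν.map_eq, map_ofReal_mul_eq hG hM.aemeasurable hGM]⟩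
  · rintro ⟨Ω, _, μ, M, hμ, hM, rfl⟩
    have := Measure.isProbabilityMeasure_map hM.aemeasurable
    exact ⟨ℝ × ℝ≥0∞, inferInstance, (gammaLaw θ).prod (μ.map M), Prod.fst, Prod.snd, inferInstance,
      ⟨by fun_prop, Measure.fst_prod⟩, hM.snd _, indepFun_prod measurable_id measurable_id, by fun_prop, rfl⟩

/-! ### Scaling by a Bernoulli variable -/

theorem theorem2p1 {Ω : Type*} [MeasurableSpace Ω] (μ : Measure Ω) [IsProbabilityMeasure μ]
    (θ σ : ℝ) (hθ : 0 < θ) (hσ : 0 < σ) (hσ1 : σ ≤ 1)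
    (X Y : Ω → ℝ≥0) (hX : AEMeasurable X μ)
    (hY : HasLaw Y (bernoulliMeasure (1 : ℝ≥0) 0 ⟨σ, hσ.le, hσ1⟩) μ)
    (hXY : IndepFun X Y μ) :
    -- (i)
    (∀ {Ω₁ Ω₂ : Type*} [MeasurableSpace Ω₁] [MeasurableSpace Ω₂]
      (μ₁ : Measure Ω₁) (μ₂ : Measure Ω₂) [IsProbabilityMeasure μ₁] [IsProbabilityMeasure μ₂]
      (B : Ω₁ → ℝ) (M : Ω₁ → ℝ≥0∞) (M' : Ω₂ → ℝ≥0∞),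
      HasLaw B (betaLaw (θ * σ) (θ * (1 - σ))) μ₁ →
      IsDirichletMean (θ * σ) (μ.map X) M μ₁ → IndepFun B M μ₁ →
      IsDirichletMean θ (μ.map (fun ω => X ω * Y ω)) M' μ₂ →
      IdentDistrib (fun ω => ENNReal.ofReal (B ω) * M ω) M' μ₁ μ₂) ∧
    -- (ii)
    (∀ {Ω₁ Ω₂ : Type*} [MeasurableSpace Ω₁] [MeasurableSpace Ω₂]
      (μ₁ : Measure Ω₁) (μ₂ : Measure Ω₂) [IsProbabilityMeasure μ₁] [IsProbabilityMeasure μ₂]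
      (N M : Ω₁ → ℝ≥0∞) (M' : Ω₂ → ℝ≥0∞),
      IsDirichletMean θ (μ.map Y) N μ₁ →
      IsDirichletMean (θ * σ) (μ.map X) M μ₁ → IndepFun N M μ₁ →
      IsDirichletMean θ (μ.map (fun ω => X ω * Y ω)) M' μ₂ →
      IdentDistrib (fun ω => N ω * M ω) M' μ₁ μ₂) ∧
    -- (iii)
    (∀ {Ω₁ Ω₂ : Type*} [MeasurableSpace Ω₁] [MeasurableSpace Ω₂]
      (μ₁ : Measure Ω₁) (μ₂ : Measure Ω₂) [IsProbabilityMeasure μ₁] [IsProbabilityMeasure μ₂]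
      (G : Ω₁ → ℝ) (M : Ω₁ → ℝ≥0∞) (G' : Ω₂ → ℝ) (M' : Ω₂ → ℝ≥0∞),
      HasLaw G (gammaLaw (θ * σ)) μ₁ →
      IsDirichletMean (θ * σ) (μ.map X) M μ₁ → IndepFun G M μ₁ →
      HasLaw G' (gammaLaw θ) μ₂ →
      IsDirichletMean θ (μ.map (fun ω => X ω * Y ω)) M' μ₂ → IndepFun G' M' μ₂ →
      IdentDistrib (fun ω => ENNReal.ofReal (G ω) * M ω)
        (fun ω => ENNReal.ofReal (G' ω) * M' ω) μ₁ μ₂) ∧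
    -- (iv)
    (∀ ν : Measure ℝ≥0∞,
      IsGGC (θ * σ) (μ.map X) ν ↔ IsGGC θ (μ.map (fun ω => X ω * Y ω)) ν) := by
  have := Measure.isProbabilityMeasure_map hX
  have := Measure.isProbabilityMeasure_map (μ := μ) (hX.mul hY.aemeasurable)
  have ha : 0 < θ * σ := mul_pos hθ hσ
  have hb : 0 ≤ θ * (1 - σ) := mul_nonneg hθ.le (by linarith)
  have hab : θ * σ + θ * (1 - σ) = θ := by ring
  have hmix : ∀ C, MeasurableSet C → (θ * σ + θ * (1 - σ)) * (μ.map fun ω => X ω * Y ω).real C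
      = θ * σ * (μ.map X).real C + θ * (1 - σ) * (Measure.dirac (0 : ℝ≥0)).real C := by
    intro C hC
    rw [map_mul_bernoulli_real hσ.le hσ1 hX hY hXY C]
    ring
  have hmixY : ∀ C, MeasurableSet C → (θ * σ + θ * (1 - σ)) * (μ.map Y).real C
      = θ * σ * (Measure.dirac (1 : ℝ≥0)).real C
        + θ * (1 - σ) * (Measure.dirac (0 : ℝ≥0)).real C := by
    intro C hC
    have h := map_mul_bernoulli_real (X := fun _ => 1) hσ.le hσ1 aemeasurable_const hY
      (indepFun_const_left 1 Y) C
    simp only [one_mul, Measure.map_const, measure_univ, one_smul] at h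
    rw [h]
    ring
  refine ⟨?_, ?_, ?_, ?_⟩
  · intro Ω₁ Ω₂ _ _ μ₁ μ₂ _ _ B M M' hB hM hBM hM'
    have h := hM.beta_mul ha hb hmix hB hBM
    rw [hab] at h
    exact h.identDistrib hM'
  · intro Ω₁ Ω₂ _ _ μ₁ μ₂ _ _ N M M' hN hM hNM hM'
    have := isProbabilityMeasure_betaLaw ha hb
    -- The mean of `F_Y` is a beta variable, by the mixture with base law `δ₁`.
    have hU := (IsDirichletMean.dirac (μ := betaLaw (θ * σ) (θ * (1 - σ))) ha 1).beta_mul ha hb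
      hmixY HasLaw.id (indepFun_const_right id _)
    rw [hab] at hU
    have hNB := hN.identDistrib hU
    have hm := Measure.isProbabilityMeasure_map hM.aemeasurable (μ := μ₁)
    have hprod := (hM.snd (betaLaw (θ * σ) (θ * (1 - σ)))).beta_mul ha hb hmix
      ⟨by fun_prop, Measure.fst_prod⟩ (indepFun_prod measurable_id measurable_id)
    rw [hab] at hprod
    refine IdentDistrib.trans ⟨hNB.aemeasurable_fst.mul hM.aemeasurable, by fun_prop, ?_⟩
      (hprod.identDistrib hM')
    have hNM' : μ₁.map (fun ω => N ω * M ω)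
        = ((μ₁.map N).prod (μ₁.map M)).map fun p => p.1 * p.2 := by
      rw [← (indepFun_iff_map_prod_eq_prod_map_map hNB.aemeasurable_fst hM.aemeasurable).1 hNM,
        AEMeasurable.map_map_of_aemeasurable (by fun_prop)
          (hNB.aemeasurable_fst.prodMk hM.aemeasurable)]
      rfl
    rw [hNM', hNB.map_eq]
    conv_lhs => rw [← Measure.map_id (μ := μ₁.map M)]
    rw [Measure.map_prod_map _ _ (by fun_prop) measurable_id,
      Measure.map_map (by fun_prop) (by fun_prop)]
    simp [Function.comp_def]
  · intro Ω₁ Ω₂ _ _ μ₁ μ₂ _ _ G M G' M' hG hM hGM hG' hM' hGM'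
    refine ⟨hG.aemeasurable.ennreal_ofReal.mul hM.aemeasurable,
      hG'.aemeasurable.ennreal_ofReal.mul hM'.aemeasurable, ?_⟩
    rw [map_ofReal_mul_eq hG hM.aemeasurable hGM, map_ofReal_mul_eq hG' hM'.aemeasurable hGM']
    rw [← hab] at hM'
    rw [hM.map_gamma_mul_eq ha hb hmix hM', hab]
  · intro ν
    rw [isGGC_iff ha, isGGC_iff hθ]
    constructor
    · rintro ⟨Ω₁, _, μ₁, M, _, hM, rfl⟩
      have := isProbabilityMeasure_betaLaw ha hb
      have := Measure.isProbabilityMeasure_map hM.aemeasurable (μ := μ₁)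
      have h := (hM.snd (betaLaw (θ * σ) (θ * (1 - σ)))).beta_mul ha hb hmix
        ⟨by fun_prop, Measure.fst_prod⟩ (indepFun_prod measurable_id measurable_id)
      have e := hM.map_gamma_mul_eq ha hb hmix h
      rw [hab] at h e
      exact ⟨_, _, _, _, inferInstance, h, e⟩
    · rintro ⟨Ω₁, _, μ₁, M', _, hM', rfl⟩
      rw [← hab] at hM'
      obtain ⟨Ω₂, _, μ₂, M, _, hM⟩ := hM'.exists_of_mixture ha hb hmix
      have e := hM.map_gamma_mul_eq ha hb hmix hM'
      rw [hab] at e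
      exact ⟨Ω₂, _, μ₂, M, inferInstance, hM, e.symm⟩
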